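/- For a metric space $(X,d)$ with a base point $x_0\in X$, let $\mathrm{Lip}(X)$ be the Banach space of Lipschitz functions $f:X\to\mathbb{R}$ with $f(x_0)=0$, normed by $\|f\|=\sup_{p\neq q}\frac{|f(p)-f(q)|}{d(p,q)}$, and let the Lipschitz free space $\mathcal{F}(X)$ be the norm closure in $\mathrm{Lip}(X)^*$ of the linear span of the evaluation functionals $\delta_p(f)=f(p)$, $p\in X$ (up to isometric isomorphism, it does not depend on the base point). A Banach space $V$ has the approximation property if every bounded linear operator $V\to V$ lies in the closure of the finite rank bounded operators in the topology of uniform convergence on compact subsets of $V$. An ideal of closed subsets of $X$ is a collection $\mathcal{I}$ of closed subsets of $X$ such that $\emptyset\in\mathcal{I}$; if $A\subseteq X$ is closed and $A\subseteq B\in\mathcal{I}$, then $A\in\mathcal{I}$; and if $A,B\in\mathcal{I}$, then $A\cup B\in\mathcal{I}$. The space $X$ is locally-$\mathcal{I}$ if for every $p\in X$ there is $\theta>0$ such that the closed ball $\{x\in X: d(x,p)\le\theta\}$ belongs to $\mathcal{I}$. Theorem. Let $X$ be a nonempty complete metric space and $\mathcal{I}$ an ideal of closed subsets of $X$ such that $X$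 is locally-$\mathcal{I}$. Suppose that for every $A\in\mathcal{I}$ there is a nonempty closed set $B\subseteq X$ such that $A\subseteq B$ and $\mathcal{F}(B)$ has the approximation property. Then $\mathcal{F}(X)$ has the approximation property. -/

import Mathlib

open scoped CompactConvergenceCLM

noncomputable section

/-- The real vector space of Lipschitz functions `f : X → ℝ` with `f x₀ = 0`. -/
def lipSubmodule (X : Type*) [MetricSpace X] (x₀ : X) : Submodule ℝ (X → ℝ) where
  carrier := {f | (∃ K, LipschitzWith K f) ∧ f x₀ = 0}
  add_mem' := by
    rintro f g ⟨⟨K, hK⟩, hf⟩ ⟨⟨L, hL⟩, hg⟩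
    exact ⟨⟨K + L, hK.add hL⟩, by simp [hf, hg]⟩
  zero_mem' := ⟨⟨0, LipschitzWith.const (0 : ℝ)⟩, rfl⟩
  smul_mem' := by
    rintro c f ⟨⟨K, hK⟩, hf⟩
    exact ⟨⟨‖c‖₊ * K, (lipschitzWith_smul c).comp hK⟩, by simp [hf]⟩

/-- `Lip(X)`: Lipschitz functions on the pointed metric space `(X, x₀)` vanishing at `x₀`. -/
def LipZero (X : Type*) [MetricSpace X] (x₀ : X) : Type _ := lipSubmodule X x₀

namespace LipZero

variable {X : Type*} [MetricSpace X] {x₀ : X}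

instance : AddCommGroup (LipZero X x₀) := inferInstanceAs (AddCommGroup (lipSubmodule X x₀))

instance : Module ℝ (LipZero X x₀) := inferInstanceAs (Module ℝ (lipSubmodule X x₀))

instance : CoeFun (LipZero X x₀) (fun _ => X → ℝ) := ⟨fun f => f.1⟩

/-- The Lipschitz norm `sup_{p ≠ q} |f p - f q| / d(p, q)` (equal to `0` on a one-point space). -/
instance : Norm (LipZero X x₀) :=
  ⟨fun f => ⨆ pq : {pq : X × X // pq.1 ≠ pq.2}, |f pq.1.1 - f pq.1.2| / dist pq.1.1 pq.1.2⟩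

theorem norm_def (f : LipZero X x₀) :
    ‖f‖ = ⨆ pq : {pq : X × X // pq.1 ≠ pq.2}, |f pq.1.1 - f pq.1.2| / dist pq.1.1 pq.1.2 := rfl

@[simp] theorem map_base (f : LipZero X x₀) : f x₀ = 0 := f.2.2

@[simp] theorem add_apply (f g : LipZero X x₀) (p : X) : (f + g) p = f p + g p := rfl

@[simp] theorem smul_apply (c : ℝ) (f : LipZero X x₀) (p : X) : (c • f) p = c * f p := rfl

@[simp] theorem zero_apply (p : X) : (0 : LipZero X x₀) p = 0 := rfl

theorem ext {f g : LipZero X x₀} (h : ∀ p, f p = g p) : f = g := Subtype.ext (funext h)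

theorem norm_nonneg' (f : LipZero X x₀) : 0 ≤ ‖f‖ :=
  Real.iSup_nonneg fun _ => by positivity

theorem abs_sub_le (f : LipZero X x₀) (p q : X) : |f p - f q| ≤ ‖f‖ * dist p q := by
  by_cases h : p = q
  · simp [h]
  · obtain ⟨K, hK⟩ := f.2.1
    have hbdd : BddAbove (Set.range fun pq : {pq : X × X // pq.1 ≠ pq.2} =>
        |f pq.1.1 - f pq.1.2| / dist pq.1.1 pq.1.2) := by
      refine ⟨K, ?_⟩
      rintro _ ⟨⟨⟨a, b⟩, hab⟩, rfl⟩
      have := hK.dist_le_mul a b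
      rw [Real.dist_eq] at this
      exact (div_le_iff₀ (dist_pos.2 hab)).2 this
    have := le_ciSup hbdd ⟨(p, q), h⟩
    exact (div_le_iff₀ (dist_pos.2 h)).1 this

theorem norm_le_of_abs_sub_le {f : LipZero X x₀} {C : ℝ} (hC : 0 ≤ C)
    (h : ∀ p q, |f p - f q| ≤ C * dist p q) : ‖f‖ ≤ C := by
  refine Real.iSup_le ?_ hC
  rintro ⟨⟨a, b⟩, hab⟩
  exact (div_le_iff₀ (dist_pos.2 hab)).2 (h a b)

theorem normedSpaceCore : NormedSpace.Core ℝ (LipZero X x₀) where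
  norm_nonneg := norm_nonneg'
  norm_smul c f := by
    rw [norm_def, norm_def, Real.norm_eq_abs, Real.mul_iSup_of_nonneg (abs_nonneg c)]
    refine iSup_congr fun pq => ?_
    rw [smul_apply, smul_apply, ← mul_sub, abs_mul, mul_div_assoc]
  norm_triangle f g := by
    refine norm_le_of_abs_sub_le (add_nonneg (norm_nonneg' f) (norm_nonneg' g)) fun p q => ?_
    have hf := abs_sub_le f p q
    have hg := abs_sub_le g p q
    calc |(f + g) p - (f + g) q| = |(f p - f q) + (g p - g q)| := by
          rw [add_apply, add_apply]; congr 1; ring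
      _ ≤ |f p - f q| + |g p - g q| := abs_add_le _ _
      _ ≤ (‖f‖ + ‖g‖) * dist p q := by linarith
  norm_eq_zero_iff f := by
    constructor
    · intro h
      refine ext fun p => ?_
      have := abs_sub_le f p x₀
      rw [h, map_base, zero_mul, sub_zero] at this
      simpa using abs_nonpos_iff.1 this
    · rintro rfl
      simp [norm_def]

instance : NormedAddCommGroup (LipZero X x₀) := NormedAddCommGroup.ofCore normedSpaceCore

instance : NormedSpace ℝ (LipZero X x₀) := NormedSpace.ofCore normedSpaceCore

/-- The evaluation functional `δ_p : f ↦ f p`, an element of `Lip(X)*`. -/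
def delta (x₀ : X) (p : X) : StrongDual ℝ (LipZero X x₀) :=
  LinearMap.mkContinuous
    { toFun := fun f => f p
      map_add' := fun f g => add_apply f g p
      map_smul' := fun c f => smul_apply c f p }
    (dist p x₀) (fun f => by
      have := abs_sub_le f p x₀
      rw [map_base, sub_zero] at this
      rw [mul_comm]
      exact this)

@[simp] theorem delta_apply (p : X) (f : LipZero X x₀) : delta x₀ p f = f p := rfl

end LipZero

/-- The Lipschitz free space `ℱ(X)` over `X` with base point `x₀`: the norm closure in `Lip(X)*`
of the linear span of the evaluation functionals. -/
abbrev LipschitzFree (X : Type*) [MetricSpace X] (x₀ : X) :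
    Submodule ℝ (StrongDual ℝ (LipZero X x₀)) :=
  (Submodule.span ℝ (Set.range (LipZero.delta x₀))).topologicalClosure

/-- The approximation property: every bounded operator on `V` belongs to the closure of the
finite rank operators for the topology of uniform convergence on compact sets. -/
def HasApproximationProperty (V : Type*) [NormedAddCommGroup V] [NormedSpace ℝ V] : Prop :=
  ∀ T : V →L_c[ℝ] V,
    T ∈ closure {S : V →L_c[ℝ] V | FiniteDimensional ℝ (LinearMap.range (S : V →ₗ[ℝ] V))}

/-- Ideals of closed subsets of a metric space. -/
structure IsClosedIdeal {X : Type*} [MetricSpace X] (I : Set (Set X)) : Prop where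
  isClosed : ∀ A ∈ I, IsClosed A
  empty_mem : ∅ ∈ I
  mem_of_subset : ∀ A B : Set X, IsClosed A → A ⊆ B → B ∈ I → A ∈ I
  union_mem : ∀ A ∈ I, ∀ B ∈ I, A ∪ B ∈ I

/-- `E` is locally modeled on `I`; balls are closed balls. -/
def LocallyModeledOn {X : Type*} [MetricSpace X] (I : Set (Set X)) (E : Set X) : Prop :=
  ∀ p ∈ E, ∃ θ : ℝ, 0 < θ ∧ E ∩ Metric.closedBall p θ ∈ I

end

/-!
If `φ : X → ℝ` is bounded and `|φ p - φ q| * d(q, x₀)` is at most a multiple of `d(p, q)`, then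
`δ_p ↦ φ p • δ_p` extends to a bounded operator on the free space. Fix a compact set `K` in the
free space and finite sets `E₀ ⊆ E₁ ⊆ …` in `X` such that the span of the `δ_p` with `p ∈ E n`
approximates `K` up to a rapidly decreasing error, and let `S n` be this operator for a cutoff `φ`
that equals `1` on `E n` and vanishes outside the neighbourhood of `E n` of width
`(1 + d(·, x₀)) / (n + 1)`. Then `‖S n‖ ≤ 2 n + 3`, whatever the sets `E n` are, so the errors can
be chosen to beat the products of these bounds: `S 0 ∘ ⋯ ∘ S n` converges uniformly on `K` to a
map that is uniformly close to the identity there. Its values are supported in the intersection of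
the neighbourhoods, which is compact, hence they lie in the isometric copy of `ℱ(B)` for some `B`
with the approximation property. A finite-rank operator on `ℱ(B)` extends to the whole free space.
-/

section ApproximationProperty

open Filter

theorem mem_closure_compactConvergence_iff {E F : Type*} [TopologicalSpace E] [AddCommGroup E]
    [Module ℝ E] [NormedAddCommGroup F] [NormedSpace ℝ F] {s : Set (E →L_c[ℝ] F)}
    {T : E →L_c[ℝ] F} :
    T ∈ closure s ↔ ∀ K : Set E, IsCompact K → ∀ ε > 0, ∃ S ∈ s, ∀ x ∈ K, ‖S x - T x‖ < ε := by
  have basis := (CompactConvergenceCLM.hasBasis_nhds_zero_of_basis (σ := RingHom.id ℝ) (E := E)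
    (F := F) Metric.nhds_basis_ball).comap (· - T)
  rw [nhds_translation_sub] at basis
  simp only [mem_closure_iff_nhds_basis basis, Prod.forall, and_imp, Set.mem_preimage,
    Set.mem_ofPred_eq, sub_apply, mem_ball_zero_iff]
  exact forall_congr' fun K => forall_comm

theorem hasApproximationProperty_iff {V : Type*} [NormedAddCommGroup V] [NormedSpace ℝ V] :
    HasApproximationProperty V ↔ ∀ K : Set V, IsCompact K → ∀ ε > 0, ∃ S : V →L[ℝ] V,
      (S : V →ₗ[ℝ] V).HasFiniteRange ∧ ∀ x ∈ K, ‖S x - x‖ < ε := by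
  simp only [HasApproximationProperty, Module.Finite.iff_fg]
  refine ⟨fun h => mem_closure_compactConvergence_iff.1 (h (ContinuousLinearMap.id ℝ V)),
    fun h T => ?_⟩
  have id_mem : (ContinuousLinearMap.id ℝ V : V →L_c[ℝ] V) ∈
      closure {S : V →L_c[ℝ] V | (S : V →ₗ[ℝ] V).HasFiniteRange} :=
    mem_closure_compactConvergence_iff.2 h
  exact map_mem_closure (ContinuousLinearMap.postcompCompactConvergenceCLM V T).continuous id_mem
    fun S (hS : LinearMap.HasFiniteRange (S : V →ₗ[ℝ] V)) =>
      LinearMap.HasFiniteRange.comp_left hS (T : V →ₗ[ℝ] V)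

theorem exists_hasFiniteRange_extension {𝕜 W E F : Type*} [RCLike 𝕜]
    [NormedAddCommGroup W] [NormedSpace 𝕜 W] [NormedAddCommGroup E] [NormedSpace 𝕜 E]
    [NormedAddCommGroup F] [NormedSpace 𝕜 F] (i : W →ₗᵢ[𝕜] E) {R : W →L[𝕜] F}
    (hR : (R : W →ₗ[𝕜] F).HasFiniteRange) :
    ∃ S : E →L[𝕜] F, (S : E →ₗ[𝕜] F).HasFiniteRange ∧ ∀ w, S (i w) = R w := by
  let ri : W ≃ₗᵢ[𝕜] LinearMap.range i.toLinearMap := i.equivRange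
  let R' : LinearMap.range i.toLinearMap →L[𝕜] LinearMap.range (R : W →ₗ[𝕜] F) :=
    R.rangeRestrict ∘L (ri.symm : LinearMap.range i.toLinearMap →L[𝕜] W)
  have : FiniteDimensional 𝕜 (LinearMap.range (R : W →ₗ[𝕜] F)) := Module.Finite.of_fg hR
  obtain ⟨S, hS⟩ := R'.exist_extension_of_finiteDimensional_range
  refine ⟨(LinearMap.range (R : W →ₗ[𝕜] F)).subtypeL ∘L S,
    LinearMap.HasFiniteRange.comp_left .of_isNoetherian_rng _, fun w => ?_⟩
  have key : R' (ri w) = S (i w) := DFunLike.congr_fun hS (ri w)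
  simp [← key, R', ri]

theorem HasApproximationProperty.exists_hasFiniteRange_norm_sub_lt {W V : Type*}
    [NormedAddCommGroup W] [NormedSpace ℝ W] [CompleteSpace W] [NormedAddCommGroup V]
    [NormedSpace ℝ V] (hW : HasApproximationProperty W) (i : W →ₗᵢ[ℝ] V) {K : Set V}
    (hK : IsCompact K) (hKi : K ⊆ Set.range i) {ε : ℝ} (hε : 0 < ε) :
    ∃ S : V →L[ℝ] V, (S : V →ₗ[ℝ] V).HasFiniteRange ∧ ∀ x ∈ K, ‖S x - x‖ < ε := by
  have hK' : IsCompact (i ⁻¹' K) := i.isometry.isClosedEmbedding.isCompact_preimage hK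
  obtain ⟨R, hR, hRK⟩ := hasApproximationProperty_iff.1 hW _ hK' ε hε
  obtain ⟨S, hS, hSi⟩ := exists_hasFiniteRange_extension i
    (R := i.toContinuousLinearMap ∘L R) (hR.comp_left _)
  refine ⟨S, hS, fun x hx => ?_⟩
  obtain ⟨w, rfl⟩ := hKi hx
  calc ‖S (i w) - i w‖ = ‖i (R w - w)‖ := by rw [hSi, map_sub]; rfl
    _ = ‖R w - w‖ := i.norm_map _
    _ < ε := hRK w hx

theorem hasApproximationProperty_of_tendstoUniformlyOn {V ι : Type*} [NormedAddCommGroup V]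
    [NormedSpace ℝ V] {l : Filter ι} [l.NeBot]
    (h : ∀ K : Set V, IsCompact K → ∀ ε > 0, ∃ (T : ι → V →L[ℝ] V) (T' : V → V),
      TendstoUniformlyOn (fun n x => T n x) T' l K ∧ (∀ x ∈ K, ‖T' x - x‖ ≤ ε) ∧
        ∃ S : V →L[ℝ] V, (S : V →ₗ[ℝ] V).HasFiniteRange ∧ ∀ y ∈ T' '' K, ‖S y - y‖ < ε) :
    HasApproximationProperty V := by
  refine hasApproximationProperty_iff.2 fun K hK ε hε => ?_
  obtain ⟨T, T', hT, hT', S, hS, hSK⟩ := h K hK (ε / 3) (by positivity)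
  have hST : TendstoUniformlyOn (fun n x => S (T n x)) (fun x => S (T' x)) l K :=
    S.uniformContinuous.comp_tendstoUniformlyOn hT
  obtain ⟨n, hn⟩ := (Metric.tendstoUniformlyOn_iff.1 hST (ε / 3) (by positivity)).exists
  refine ⟨S ∘L T n, hS.comp_right _, fun x hx => ?_⟩
  simp only [← dist_eq_norm] at hT' hSK ⊢
  calc dist (S (T n x)) x
      ≤ dist (S (T n x)) (S (T' x)) + dist (S (T' x)) (T' x) + dist (T' x) x :=
        dist_triangle4 _ _ _ _
    _ < ε / 3 + ε / 3 + ε / 3 :=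
        add_lt_add_of_lt_of_le (add_lt_add (dist_comm (S (T' x)) _ ▸ hn x hx) (hSK _ ⟨x, hx, rfl⟩))
          (hT' x hx)
    _ = ε := by ring

end ApproximationProperty

section FiniteApproximation

variable {𝕜 V ι : Type*} [NormedField 𝕜] [SeminormedAddCommGroup V] [NormedSpace 𝕜 V]

theorem exists_finset_subset_thickening_span {v : ι → V} {K : Set V} (hK : IsCompact K)
    (hKv : K ⊆ closure (Submodule.span 𝕜 (Set.range v))) {η : ℝ} (hη : 0 < η) :
    ∃ E : Finset ι, K ⊆ Metric.thickening η (Submodule.span 𝕜 (v '' E)) := by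
  classical
  refine hK.elim_directed_cover
    (fun E : Finset ι => Metric.thickening η (Submodule.span 𝕜 (v '' E)))
    (fun _ => Metric.isOpen_thickening) (fun x hx => ?_) (Monotone.directed_le fun E F hEF => ?_)
  · obtain ⟨y, hy, hxy⟩ := Metric.mem_thickening_iff.1
      (Metric.closure_subset_thickening hη _ (hKv hx))
    obtain ⟨t, ht, hyt⟩ := Submodule.mem_span_finite_of_mem_span hy
    rw [← Set.image_univ] at ht
    obtain ⟨E, -, rfl⟩ := Finset.subset_set_image_iff.1 ht
    rw [Finset.coe_image] at hyt
    exact Set.mem_iUnion.2 ⟨E, Metric.mem_thickening_iff.2 ⟨y, hyt, hxy⟩⟩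
  · exact Metric.thickening_subset_of_subset _ (Submodule.span_mono (Set.image_mono hEF))

theorem exists_monotone_finset_subset_thickening_span {v : ι → V} {K : Set V} (hK : IsCompact K)
    (hKv : K ⊆ closure (Submodule.span 𝕜 (Set.range v))) (i₀ : ι) {η : ℕ → ℝ}
    (hη : ∀ n, 0 < η n) :
    ∃ E : ℕ → Finset ι, Monotone E ∧ (∀ n, i₀ ∈ E n) ∧
      ∀ n, K ⊆ Metric.thickening (η n) (Submodule.span 𝕜 (v '' E n)) := by
  classical
  choose E hE using fun n => exists_finset_subset_thickening_span hK hKv (hη n)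
  let F := partialSups fun n => insert i₀ (E n)
  have hF : ∀ n, insert i₀ (E n) ⊆ F n := le_partialSups fun n => insert i₀ (E n)
  refine ⟨F, F.monotone, fun n => hF n (Finset.mem_insert_self _ _), fun n => (hE n).trans ?_⟩
  exact Metric.thickening_subset_of_subset _ <| Submodule.span_mono <| Set.image_mono <|
    Finset.coe_subset.2 ((Finset.subset_insert _ _).trans (hF n))

end FiniteApproximation

section PartialProducts

open Filter

theorem tendsto_div_two_pow (a : ℝ) : Tendsto (fun n : ℕ => a / 2 ^ n) atTop (nhds 0) :=
  tendsto_const_nhds.div_atTop (tendsto_pow_atTop_atTop_of_one_lt one_lt_two)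

theorem exists_tendstoUniformlyOn_of_dist_le_geometric_two {α β : Type*} [Nonempty β]
    [PseudoMetricSpace β] [CompleteSpace β] {f : ℕ → α → β} {s : Set α} {ε : ℝ}
    (hf : ∀ n, ∀ x ∈ s, dist (f n x) (f (n + 1) x) ≤ ε / 2 / 2 ^ n) :
    ∃ g, TendstoUniformlyOn f g atTop s ∧ ∀ x ∈ s, dist (f 0 x) (g x) ≤ ε := by
  have hlim : ∀ x ∈ s, ∃ y, Tendsto (f · x) atTop (nhds y) := fun x hx =>
    cauchySeq_tendsto_of_complete (cauchySeq_of_le_geometric_two (hf · x hx))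
  choose! g hg using hlim
  refine ⟨g, Metric.tendstoUniformlyOn_iff.2 fun r hr => ?_, fun x hx =>
    dist_le_of_le_geometric_two_of_tendsto₀ (hf · x hx) (hg x hx)⟩
  filter_upwards [(tendsto_div_two_pow ε).eventually_lt_const hr] with n hn x hx
  rw [dist_comm]
  exact (dist_le_of_le_geometric_two_of_tendsto (hf · x hx) (hg x hx) n).trans_lt hn

variable {𝕜 V : Type*} [NontriviallyNormedField 𝕜] [NormedAddCommGroup V] [NormedSpace 𝕜 V]

theorem prod_map_range_apply_of_forall_eq_smul {S : ℕ → V →L[𝕜] V} {c : ℕ → 𝕜} {v : V}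
    (h : ∀ n, S n v = c n • v) (n : ℕ) :
    ((List.range n).map S).prod v = (∏ m ∈ Finset.range n, c m) • v := by
  induction n with
  | zero => simp
  | succ n ih =>
    rw [List.prod_range_succ, mul_apply_eq_comp, h, map_smul, ih, smul_smul,
      Finset.prod_range_succ, mul_comm]

theorem norm_prod_map_range_le {S : ℕ → V →L[𝕜] V} {c : ℕ → ℝ} (h : ∀ n, ‖S n‖ ≤ c n) (n : ℕ) :
    ‖((List.range n).map S).prod‖ ≤ ∏ m ∈ Finset.range n, c m := by
  induction n with
  | zero => simpa using! ContinuousLinearMap.norm_id_le (𝕜 := 𝕜) (E := V)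
  | succ n ih =>
    rw [List.prod_range_succ, Finset.prod_range_succ]
    exact (norm_mul_le _ _).trans
      (mul_le_mul ih (h n) (norm_nonneg _) ((norm_nonneg _).trans ih))

theorem norm_apply_sub_le_of_apply_eq {S : V →L[𝕜] V} {ν : V} (hν : S ν = ν) (μ : V) :
    ‖S μ - μ‖ ≤ (‖S‖ + 1) * ‖μ - ν‖ :=
  calc ‖S μ - μ‖ = ‖S (μ - ν) - (μ - ν)‖ := by rw [map_sub, hν, sub_sub_sub_cancel_right]
    _ ≤ ‖S‖ * ‖μ - ν‖ + ‖μ - ν‖ := (norm_sub_le _ _).trans (by gcongr; exact S.le_opNorm _)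
    _ = (‖S‖ + 1) * ‖μ - ν‖ := by ring

theorem exists_mem_norm_prod_mul_le {S : ℕ → V →L[𝕜] V} {b : ℕ → ℝ} (hS : ∀ n, ‖S n‖ + 1 ≤ b n)
    {n : ℕ} {η : ℝ} {P : Set V} {μ : V}
    (hμ : μ ∈ Metric.thickening (η / ∏ m ∈ Finset.range (n + 1), b m) P) :
    ∃ ν ∈ P, ‖((List.range n).map S).prod‖ * ((‖S n‖ + 1) * ‖μ - ν‖) ≤ η := by
  have hb (n : ℕ) : 0 < b n := (add_pos_of_nonneg_of_pos (norm_nonneg _) one_pos).trans_le (hS n)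
  have hprod (n : ℕ) : 0 < ∏ m ∈ Finset.range n, b m := Finset.prod_pos fun m _ => hb m
  obtain ⟨ν, hν, hμν⟩ := Metric.mem_thickening_iff.1 hμ
  refine ⟨ν, hν, ?_⟩
  calc ‖((List.range n).map S).prod‖ * ((‖S n‖ + 1) * ‖μ - ν‖)
      ≤ (∏ m ∈ Finset.range n, b m) * (b n * ‖μ - ν‖) := by
        have hSb (n : ℕ) : ‖S n‖ ≤ b n := (le_add_of_nonneg_right zero_le_one).trans (hS n)
        gcongr
        · exact (hprod n).le
        · exact norm_prod_map_range_le hSb n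
        · exact hS n
    _ = dist μ ν * ∏ m ∈ Finset.range (n + 1), b m := by
        rw [Finset.prod_range_succ, dist_eq_norm]; ring
    _ ≤ η := ((lt_div_iff₀ (hprod _)).1 hμν).le

theorem exists_tendstoUniformlyOn_prod_of_apply_eq [CompleteSpace V] {S : ℕ → V →L[𝕜] V}
    {P : ℕ → Set V} (hP : ∀ n, ∀ ν ∈ P n, S n ν = ν) {C : Set V} (hC : IsClosed C)
    (hPC : ∀ n, ∀ ν ∈ P n, ((List.range n).map S).prod ν ∈ C) {K : Set V} {ε : ℝ}
    (hK : ∀ n, ∀ μ ∈ K, ∃ ν ∈ P n,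
      ‖((List.range n).map S).prod‖ * ((‖S n‖ + 1) * ‖μ - ν‖) ≤ ε / 2 / 2 ^ n) :
    ∃ T' : V → V, TendstoUniformlyOn (fun n μ => ((List.range n).map S).prod μ) T' atTop K ∧
      (∀ μ ∈ K, ‖T' μ - μ‖ ≤ ε) ∧ Set.MapsTo T' K C := by
  let T (n : ℕ) : V →L[𝕜] V := ((List.range n).map S).prod
  have hstep : ∀ n, ∀ μ ∈ K, dist (T n μ) (T (n + 1) μ) ≤ ε / 2 / 2 ^ n := by
    intro n μ hμ
    obtain ⟨ν, hν, hμν⟩ := hK n μ hμ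
    calc dist (T n μ) (T (n + 1) μ) = ‖T n (S n μ - μ)‖ := by
          rw [dist_comm, dist_eq_norm, map_sub]
          simp only [T, List.prod_range_succ, mul_apply_eq_comp]
      _ ≤ ‖T n‖ * ‖S n μ - μ‖ := (T n).le_opNorm _
      _ ≤ ‖T n‖ * ((‖S n‖ + 1) * ‖μ - ν‖) := by
          gcongr
          exact norm_apply_sub_le_of_apply_eq (hP n ν hν) μ
      _ ≤ ε / 2 / 2 ^ n := hμν
  obtain ⟨T', hTT', hT'⟩ := exists_tendstoUniformlyOn_of_dist_le_geometric_two hstep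
  refine ⟨T', hTT', fun μ hμ => ?_, fun μ hμ => ?_⟩
  · simpa only [dist_eq_norm'] using! hT' μ hμ
  · choose ν hν hμν using fun n => hK n μ hμ
    have hTν : Tendsto (fun n => dist (T n μ) (T n (ν n))) atTop (nhds 0) := by
      refine squeeze_zero (fun _ => dist_nonneg) (fun n => ?_) (tendsto_div_two_pow (ε / 2))
      rw [dist_eq_norm, ← map_sub]
      refine ((T n).le_opNorm _).trans (le_trans ?_ (hμν n))
      gcongr
      exact le_mul_of_one_le_left (norm_nonneg _) (le_add_of_nonneg_left (norm_nonneg _))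
    exact hC.mem_of_tendsto ((hTT'.tendsto_at hμ).congr_dist hTν)
      (.of_forall fun n => hPC n _ (hν n))

end PartialProducts

section Cutoff

open Metric

variable {X : Type*} [PseudoMetricSpace X] {ρ : X → ℝ} {E : Set X}

/-- A cutoff function for `E` of variable width `ρ`: it equals `1` on `E` and vanishes at every
point `x` whose distance to `E` is at least `ρ x`. -/
noncomputable def cutoff (ρ : X → ℝ) (E : Set X) (x : X) : ℝ :=
  1 - min (infDist x E) (ρ x) / ρ x

theorem cutoff_eq_one {x : X} (hρ : 0 ≤ ρ x) (hx : x ∈ E) : cutoff ρ E x = 1 := by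
  rw [cutoff, infDist_zero_of_mem hx, min_eq_left hρ, zero_div, sub_zero]

theorem cutoff_eq_zero {x : X} (hρ : 0 < ρ x) (hx : ρ x ≤ infDist x E) : cutoff ρ E x = 0 := by
  rw [cutoff, min_eq_right hx, div_self hρ.ne', sub_self]

theorem cutoff_mem_Icc {x : X} (hρ : 0 < ρ x) : cutoff ρ E x ∈ Set.Icc 0 1 :=
  ⟨sub_nonneg.2 (div_le_one_of_le₀ (min_le_right _ _) hρ.le),
    sub_le_self _ (div_nonneg (le_min infDist_nonneg hρ.le) hρ.le)⟩

theorem mul_abs_cutoff_sub_cutoff_le (hρ : ∀ x, 0 < ρ x) (hρ' : LipschitzWith 1 ρ) (x y : X) :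
    ρ y * |cutoff ρ E x - cutoff ρ E y| ≤ 2 * dist x y := by
  let m (x : X) : ℝ := min (infDist x E) (ρ x)
  have hm : |m y - m x| ≤ dist x y := by
    have := ((lipschitz_infDist_pt E).min hρ').dist_le_mul y x
    rwa [max_self, NNReal.coe_one, one_mul, dist_comm y x] at this
  have hρxy : |ρ x - ρ y| ≤ dist x y := by
    simpa only [NNReal.coe_one, one_mul, Real.dist_eq] using hρ'.dist_le_mul x y
  have hmρ : |m x / ρ x| ≤ 1 := by
    rw [abs_of_nonneg (div_nonneg (le_min infDist_nonneg (hρ x).le) (hρ x).le)]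
    exact div_le_one_of_le₀ (min_le_right _ _) (hρ x).le
  have hx := (hρ x).ne'
  have hy := (hρ y).ne'
  calc ρ y * |cutoff ρ E x - cutoff ρ E y|
      = |ρ y * (cutoff ρ E x - cutoff ρ E y)| := by rw [abs_mul, abs_of_pos (hρ y)]
    _ = |(m y - m x) + m x / ρ x * (ρ x - ρ y)| := by
        simp only [cutoff, m]
        congr 1
        field_simp
        ring
    _ ≤ |m y - m x| + |m x / ρ x| * |ρ x - ρ y| := by
        rw [← abs_mul]
        exact abs_add_le _ _
    _ ≤ dist x y + 1 * dist x y := by gcongr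
    _ = 2 * dist x y := by ring

theorem infDist_le_of_prod_cutoff_ne_zero {E : ℕ → Set X} (hE : Monotone E) {ρ : ℕ → X → ℝ}
    (hρ : ∀ n x, 0 < ρ n x) {n : ℕ} {x : X} (hx : x ∈ E n)
    (h : ∏ m ∈ Finset.range n, cutoff (ρ m) (E m) x ≠ 0) (m : ℕ) : infDist x (E m) ≤ ρ m x := by
  rcases lt_or_ge m n with hmn | hnm
  · refine (lt_of_not_ge fun hle => ?_).le
    exact Finset.prod_ne_zero_iff.1 h m (Finset.mem_range.2 hmn) (cutoff_eq_zero (hρ m x) hle)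
  · exact (infDist_zero_of_mem (hE hnm hx)).trans_le (hρ m x).le

theorem lipschitzWith_one_const_mul_one_add_dist {δ : ℝ} (hδ : 0 ≤ δ) (hδ1 : δ ≤ 1) (x₀ : X) :
    LipschitzWith 1 fun x => δ * (1 + dist x x₀) :=
  LipschitzWith.of_dist_le_mul fun x y => by
    rw [Real.dist_eq, ← mul_sub, add_sub_add_left_eq_sub, abs_mul, abs_of_nonneg hδ]
    exact mul_le_mul hδ1 (abs_dist_sub_le x y x₀) (abs_nonneg _) zero_le_one

end Cutoff

section Compactness

open Metric Filter

variable {X : Type*} [PseudoMetricSpace X]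

theorem dist_le_infDist_add {E : Set X} (hE : E.Nonempty) {x₀ : X} {r : ℝ}
    (hEr : E ⊆ closedBall x₀ r) (x : X) : dist x x₀ ≤ infDist x E + r :=
  sub_le_iff_le_add.1 <| (le_infDist hE).2 fun y hy =>
    sub_le_iff_le_add.2 <| (dist_triangle x y x₀).trans (by gcongr; exact hEr hy)

theorem isBounded_setOf_infDist_le {E : Set X} (hE : Bornology.IsBounded E) (hE' : E.Nonempty)
    {δ : ℝ} (hδ : δ < 1) (x₀ : X) :
    Bornology.IsBounded {x | infDist x E ≤ δ * (1 + dist x x₀)} := by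
  obtain ⟨r, hr⟩ := hE.subset_closedBall x₀
  refine isBounded_closedBall.subset
    (fun x (hx : infDist x E ≤ δ * (1 + dist x x₀)) => (?_ : x ∈ closedBall x₀ ((r + δ) / (1 - δ))))
  rw [mem_closedBall, le_div_iff₀ (sub_pos.2 hδ)]
  linarith [dist_le_infDist_add hE' hr x]

theorem isCompact_setOf_forall_infDist_le [CompleteSpace X] {E : ℕ → Set X}
    (hE : ∀ n, (E n).Finite) (hE' : ∀ n, (E n).Nonempty) {δ : ℕ → ℝ}
    (hδ : Tendsto δ atTop (nhds 0)) (x₀ : X) :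
    IsCompact {x | ∀ n, infDist x (E n) ≤ δ n * (1 + dist x x₀)} := by
  refine TotallyBounded.isCompact_of_isClosed (Metric.totallyBounded_iff.2 fun ε hε => ?_) ?_
  · obtain ⟨n, hn⟩ := (hδ.eventually_lt_const one_pos).exists
    obtain ⟨r, hr⟩ := (isBounded_setOf_infDist_le (hE n).isBounded (hE' n) hn x₀).subset_closedBall
      x₀
    have hδr : Tendsto (fun n => |δ n| * (1 + r)) atTop (nhds 0) := by
      simpa using hδ.abs.mul_const (1 + r)
    obtain ⟨m, hm⟩ := (hδr.eventually_lt_const hε).exists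
    refine ⟨E m, hE m, fun x hx => ?_⟩
    have hxr : dist x x₀ ≤ r := hr (hx n)
    have hxm : infDist x (E m) < ε :=
      calc infDist x (E m) ≤ δ m * (1 + dist x x₀) := hx m
        _ ≤ |δ m| * (1 + r) := by gcongr; exact le_abs_self _
        _ < ε := hm
    simpa [dist_comm] using (infDist_lt_iff (hE' m)).1 hxm
  · simp only [Set.ofPred_forall]
    exact isClosed_iInter fun n => isClosed_le (by fun_prop) (by fun_prop)

end Compactness

namespace LipZero

variable {X : Type*} [MetricSpace X] {B : Set X} {b₀ : B}

theorem exists_extension (x₀ : X) (g : LipZero B b₀) :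
    ∃ f : LipZero X x₀, ‖f‖ ≤ ‖g‖ ∧ ∀ b : B, f b - f b₀ = g b := by
  have hg : LipschitzOnWith ‖g‖₊ (Function.extend Subtype.val g 0) B :=
    LipschitzOnWith.of_dist_le_mul fun x hx y hy => by
      lift x to B using hx
      lift y to B using hy
      rw [Subtype.val_injective.extend_apply, Subtype.val_injective.extend_apply]
      exact abs_sub_le g x y
  obtain ⟨f, hf, hfg⟩ := hg.extend_real
  have hfB (b : B) : f b = g b := by rw [← hfg b.2, Subtype.val_injective.extend_apply]
  refine ⟨(⟨fun p => f p - f x₀, ⟨_, hf.sub (.const _)⟩, sub_self _⟩ : lipSubmodule X x₀),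
    norm_le_of_abs_sub_le (norm_nonneg g) fun p q => ?_, fun b => ?_⟩
  · change |(f p - f x₀) - (f q - f x₀)| ≤ _
    rw [sub_sub_sub_cancel_right]
    exact hf.dist_le_mul p q
  · change (f b - f x₀) - (f b₀ - f x₀) = g b
    rw [sub_sub_sub_cancel_right, hfB, hfB, map_base, sub_zero]

end LipZero

namespace LipschitzFree

open scoped NNReal

-- `LipschitzFree X x₀` is a coerced submodule; at the default depth its normed structure is not
-- found in the search for an operator norm.
set_option maxSynthPendingDepth 3

section Dirac

variable {X : Type*} [MetricSpace X] {x₀ : X}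

instance : CompleteSpace (LipschitzFree X x₀) :=
  (Submodule.isClosed_topologicalClosure _).completeSpace_coe

/-- The evaluation functional `δ_p` as a point of the free space. -/
noncomputable def dirac (x₀ p : X) : LipschitzFree X x₀ :=
  ⟨LipZero.delta x₀ p, Submodule.le_topologicalClosure _ (Submodule.subset_span ⟨p, rfl⟩)⟩

@[simp] theorem dirac_base : dirac x₀ x₀ = 0 :=
  Subtype.ext (ContinuousLinearMap.ext LipZero.map_base)

theorem norm_dirac_sub_dirac_le (p q : X) : ‖dirac x₀ p - dirac x₀ q‖ ≤ dist p q :=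
  ContinuousLinearMap.opNorm_le_bound _ dist_nonneg fun f =>
    (LipZero.abs_sub_le f p q).trans_eq (mul_comm _ _)

theorem norm_dirac_le (p : X) : ‖dirac x₀ p‖ ≤ dist p x₀ := by
  simpa using norm_dirac_sub_dirac_le (x₀ := x₀) p x₀

theorem dense_span_range_dirac :
    Dense (Submodule.span ℝ (Set.range (dirac x₀)) : Set (LipschitzFree X x₀)) := by
  have himage : Subtype.val '' (Submodule.span ℝ (Set.range (dirac x₀)) : Set (LipschitzFree X x₀))
      = Submodule.span ℝ (Set.range (LipZero.delta x₀)) := by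
    rw [← Submodule.coe_subtype, ← Submodule.map_coe, Submodule.map_span, ← Set.range_comp]
    rfl
  exact Subtype.dense_iff.2 (congrArg closure himage).superset

variable {W : Type*} [TopologicalSpace W] [AddCommMonoid W] [Module ℝ W]

theorem hom_ext [T2Space W] {f g : LipschitzFree X x₀ →L[ℝ] W}
    (h : ∀ p, f (dirac x₀ p) = g (dirac x₀ p)) : f = g :=
  ContinuousLinearMap.ext_on dense_span_range_dirac (Set.eqOn_range.2 (funext h))

theorem apply_mem_of_forall_dirac_mem {f : LipschitzFree X x₀ →L[ℝ] W} {F : Submodule ℝ W}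
    (hF : IsClosed (F : Set W)) (h : ∀ p, f (dirac x₀ p) ∈ F) (μ : LipschitzFree X x₀) :
    f μ ∈ F := by
  have hspan : Submodule.span ℝ (Set.range (dirac x₀)) ≤ F.comap (f : LipschitzFree X x₀ →ₗ[ℝ] W) :=
    Submodule.span_le.2 (Set.range_subset_iff.2 h)
  exact (hF.preimage f.continuous).closure_subset_iff.2 hspan (dense_span_range_dirac μ)

end Dirac

section Lift

variable {X : Type*} [MetricSpace X] {x₀ : X} {W : Type*} [NormedAddCommGroup W] [NormedSpace ℝ W]
  {g : X → W} {C : ℝ≥0}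

/-- Composition with a Lipschitz map `g` vanishing at the base point, as an operator
`W* → Lip(X)`. Its adjoint extends `δ_p ↦ g p`. -/
noncomputable def compDual (hg : LipschitzWith C g) (h0 : g x₀ = 0) :
    StrongDual ℝ W →L[ℝ] LipZero X x₀ :=
  LinearMap.mkContinuous
    { toFun := fun w => (⟨w ∘ g, ⟨_, w.lipschitz.comp hg⟩, by simp [h0]⟩ : lipSubmodule X x₀)
      map_add' := fun _ _ => rfl
      map_smul' := fun _ _ => rfl } C fun w => by
    refine LipZero.norm_le_of_abs_sub_le (by positivity) fun p q => ?_
    calc |w (g p) - w (g q)| = ‖w (g p - g q)‖ := by rw [map_sub, Real.norm_eq_abs]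
      _ ≤ ‖w‖ * (C * dist p q) :=
        w.le_opNorm_of_le (by rw [← dist_eq_norm]; exact hg.dist_le_mul p q)
      _ = C * ‖w‖ * dist p q := by ring

theorem norm_compDual_le (hg : LipschitzWith C g) (h0 : g x₀ = 0) : ‖compDual hg h0‖ ≤ C :=
  LinearMap.mkContinuous_norm_le _ C.2 _

/-- The adjoint of `compDual` on the free space, with values in the bidual of `W`. -/
noncomputable def liftBidual (hg : LipschitzWith C g) (h0 : g x₀ = 0) :
    LipschitzFree X x₀ →L[ℝ] StrongDual ℝ (StrongDual ℝ W) :=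
  ContinuousLinearMap.precomp ℝ (compDual hg h0) ∘L (LipschitzFree X x₀).subtypeL

theorem norm_liftBidual_apply_le (hg : LipschitzWith C g) (h0 : g x₀ = 0) (μ : LipschitzFree X x₀) :
    ‖liftBidual hg h0 μ‖ ≤ C * ‖μ‖ :=
  calc ‖liftBidual hg h0 μ‖ ≤ ‖(μ : StrongDual ℝ (LipZero X x₀))‖ * ‖compDual hg h0‖ :=
        ContinuousLinearMap.opNorm_comp_le _ _
    _ ≤ ‖μ‖ * C := by gcongr; exacts [le_rfl, norm_compDual_le hg h0]
    _ = C * ‖μ‖ := mul_comm _ _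

variable [CompleteSpace W]

theorem liftBidual_mem_range (hg : LipschitzWith C g) (h0 : g x₀ = 0) (μ : LipschitzFree X x₀) :
    liftBidual hg h0 μ ∈
      LinearMap.range (NormedSpace.inclusionInDoubleDualLi ℝ (E := W)).toLinearMap := by
  refine apply_mem_of_forall_dirac_mem ?_ (fun p => LinearMap.mem_range.2 ⟨g p, rfl⟩) μ
  rw [LinearMap.coe_range]
  exact (NormedSpace.inclusionInDoubleDualLi ℝ (E := W)).isometry.isClosedEmbedding.isClosed_range

/-- The universal property of the free space: a Lipschitz map into a Banach space which vanishes at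
the base point extends to a bounded operator along `p ↦ δ_p`. -/
noncomputable def lift (hg : LipschitzWith C g) (h0 : g x₀ = 0) : LipschitzFree X x₀ →L[ℝ] W :=
  ((NormedSpace.inclusionInDoubleDualLi ℝ (E := W)).equivRange.symm : _ →L[ℝ] W) ∘L
    (liftBidual hg h0).codRestrict _ (liftBidual_mem_range hg h0)

@[simp] theorem lift_dirac (hg : LipschitzWith C g) (h0 : g x₀ = 0) (p : X) :
    lift hg h0 (dirac x₀ p) = g p :=
  (LinearIsometryEquiv.symm_apply_eq _).2 rfl

theorem norm_lift_le (hg : LipschitzWith C g) (h0 : g x₀ = 0) : ‖lift hg h0‖ ≤ C :=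
  ContinuousLinearMap.opNorm_le_bound _ C.2 fun μ =>
    (LinearIsometryEquiv.norm_map
      (NormedSpace.inclusionInDoubleDualLi ℝ (E := W)).equivRange.symm _).trans_le
      (norm_liftBidual_apply_le hg h0 μ)

end Lift

section Support

variable {X : Type*} [MetricSpace X] {x₀ : X} {A M : Set X}

/-- The closed linear span of the `δ_p` with `p ∈ A`: the elements of the free space supported
in the closure of `A`. -/
noncomputable def supportedIn (x₀ : X) (A : Set X) : Submodule ℝ (LipschitzFree X x₀) :=
  (Submodule.span ℝ (dirac x₀ '' A)).topologicalClosure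

theorem isClosed_supportedIn : IsClosed (supportedIn x₀ A : Set (LipschitzFree X x₀)) :=
  Submodule.isClosed_topologicalClosure _

theorem dirac_mem_supportedIn {p : X} (hp : p ∈ A) : dirac x₀ p ∈ supportedIn x₀ A :=
  Submodule.le_topologicalClosure _ (Submodule.subset_span ⟨p, hp, rfl⟩)

theorem supportedIn_mono (h : A ⊆ M) : supportedIn x₀ A ≤ supportedIn x₀ M :=
  Submodule.topologicalClosure_mono (Submodule.span_mono (Set.image_mono h))

theorem apply_mem_supportedIn {T : LipschitzFree X x₀ →L[ℝ] LipschitzFree X x₀} {c : X → ℝ}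
    (hT : ∀ p, T (dirac x₀ p) = c p • dirac x₀ p) (hc : ∀ p ∈ A, c p ≠ 0 → p ∈ M)
    {ν : LipschitzFree X x₀} (hν : ν ∈ Submodule.span ℝ (dirac x₀ '' A)) :
    T ν ∈ supportedIn x₀ M := by
  refine (Submodule.span_le.2 ?_ :
    Submodule.span ℝ (dirac x₀ '' A) ≤ (supportedIn x₀ M).comap T.toLinearMap) hν
  rintro _ ⟨p, hp, rfl⟩
  change T (dirac x₀ p) ∈ supportedIn x₀ M
  rw [hT]
  by_cases hcp : c p = 0
  · simp [hcp]
  · exact Submodule.smul_mem _ _ (dirac_mem_supportedIn (hc p hp hcp))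

end Support

section Weighting

variable {X : Type*} [MetricSpace X] {x₀ : X}

theorem lipschitzWith_smul_dirac {φ : X → ℝ} {a b : ℝ≥0} (ha : ∀ p, |φ p| ≤ a)
    (hb : ∀ p q, |φ p - φ q| * dist q x₀ ≤ b * dist p q) :
    LipschitzWith (a + b) fun p => φ p • dirac x₀ p := by
  refine LipschitzWith.of_dist_le_mul fun p q => ?_
  calc dist (φ p • dirac x₀ p) (φ q • dirac x₀ q)
      = ‖φ p • (dirac x₀ p - dirac x₀ q) + (φ p - φ q) • dirac x₀ q‖ := by
        rw [dist_eq_norm]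
        congr 1
        module
    _ ≤ |φ p| * ‖dirac x₀ p - dirac x₀ q‖ + |φ p - φ q| * ‖dirac x₀ q‖ :=
        norm_add_le_of_le (norm_smul_le _ _) (norm_smul_le _ _)
    _ ≤ a * dist p q + |φ p - φ q| * dist q x₀ := by
        gcongr
        exacts [ha p, norm_dirac_sub_dirac_le p q, norm_dirac_le q]
    _ ≤ (a + b : ℝ≥0) * dist p q := by
        rw [NNReal.coe_add, add_mul]
        exact add_le_add le_rfl (hb p q)

theorem exists_apply_dirac_eq_cutoff_smul {ρ : X → ℝ} (hρ : ∀ x, 0 < ρ x)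
    (hρ' : LipschitzWith 1 ρ) {r : ℝ≥0} (hr : ∀ x, dist x x₀ ≤ r * ρ x) (E : Set X) :
    ∃ S : LipschitzFree X x₀ →L[ℝ] LipschitzFree X x₀,
      ‖S‖ ≤ 1 + 2 * r ∧ ∀ p, S (dirac x₀ p) = cutoff ρ E p • dirac x₀ p := by
  have hlip : LipschitzWith (1 + 2 * r) fun p => cutoff ρ E p • dirac x₀ p := by
    refine lipschitzWith_smul_dirac (fun p => ?_) fun p q => ?_
    · obtain ⟨h0, h1⟩ := cutoff_mem_Icc (E := E) (hρ p)
      rwa [abs_of_nonneg h0]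
    · calc |cutoff ρ E p - cutoff ρ E q| * dist q x₀
          ≤ |cutoff ρ E p - cutoff ρ E q| * (r * ρ q) := by gcongr; exact hr q
        _ = r * (ρ q * |cutoff ρ E p - cutoff ρ E q|) := by ring
        _ ≤ r * (2 * dist p q) :=
          mul_le_mul_of_nonneg_left (mul_abs_cutoff_sub_cutoff_le hρ hρ' p q) r.2
        _ = (2 * r : ℝ≥0) * dist p q := by push_cast; ring
  have h0 : cutoff ρ E x₀ • dirac x₀ x₀ = 0 := by rw [dirac_base, smul_zero]
  exact ⟨lift hlip h0, by simpa using norm_lift_le hlip h0, lift_dirac hlip h0⟩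

theorem exists_tendstoUniformlyOn_mapsTo_supportedIn_isCompact [CompleteSpace X]
    {K : Set (LipschitzFree X x₀)} (hK : IsCompact K) {ε : ℝ} (hε : 0 < ε) :
    ∃ M : Set X, IsCompact M ∧
      ∃ (T : ℕ → LipschitzFree X x₀ →L[ℝ] LipschitzFree X x₀)
        (T' : LipschitzFree X x₀ → LipschitzFree X x₀),
        TendstoUniformlyOn (fun n μ => T n μ) T' Filter.atTop K ∧ (∀ μ ∈ K, ‖T' μ - μ‖ ≤ ε) ∧
          Set.MapsTo T' K (supportedIn x₀ M) := by
  -- `b n` bounds `‖S n‖ + 1` whatever the sets `E n` are, so their choice may depend on it.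
  let b (n : ℕ) : ℝ := 1 + 2 * (n + 1 : ℝ≥0) + 1
  obtain ⟨E, hE, hx₀E, hKE⟩ := exists_monotone_finset_subset_thickening_span (𝕜 := ℝ) hK
    (fun μ _ => dense_span_range_dirac μ) x₀
    (η := fun n => ε / 2 / 2 ^ n / ∏ m ∈ Finset.range (n + 1), b m)
    fun n => div_pos (by positivity) (Finset.prod_pos fun m _ => by positivity)
  let ρ (n : ℕ) (x : X) : ℝ := 1 / (n + 1 : ℝ) * (1 + dist x x₀)
  have hρ (n : ℕ) (x : X) : 0 < ρ n x := by positivity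
  have hρ' (n : ℕ) : LipschitzWith 1 (ρ n) :=
    lipschitzWith_one_const_mul_one_add_dist (by positivity)
      (div_le_one_of_le₀ (le_add_of_nonneg_left n.cast_nonneg) (by positivity)) x₀
  have hr (n : ℕ) (x : X) : dist x x₀ ≤ (n + 1 : ℝ≥0) * ρ n x := by
    simp only [ρ]
    push_cast
    rw [← mul_assoc, mul_one_div_cancel n.cast_add_one_ne_zero, one_mul]
    linarith
  choose S hSnorm hSdirac using fun n =>
    exists_apply_dirac_eq_cutoff_smul (hρ n) (hρ' n) (hr n) (E n)
  let M : Set X := {x | ∀ n, Metric.infDist x (E n) ≤ ρ n x}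
  have hM : IsCompact M := isCompact_setOf_forall_infDist_le (fun n => (E n).finite_toSet)
    (fun n => ⟨x₀, hx₀E n⟩) tendsto_one_div_add_atTop_nhds_zero_nat x₀
  refine ⟨M, hM, fun n => ((List.range n).map S).prod, ?_⟩
  refine exists_tendstoUniformlyOn_prod_of_apply_eq
    (P := fun n => Submodule.span ℝ (dirac x₀ '' E n)) (fun n ν hν => ?_) isClosed_supportedIn
    (fun n ν hν => ?_) fun n μ hμ => ?_
  · refine LinearMap.eqOn_span (f := (S n).toLinearMap) (g := LinearMap.id) ?_ hν
    rintro _ ⟨p, hp, rfl⟩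
    simp [hSdirac, cutoff_eq_one (hρ n p).le hp]
  · refine apply_mem_supportedIn (fun p => prod_map_range_apply_of_forall_eq_smul
      (fun m => hSdirac m p) n) (fun p hp hne => ?_) hν
    exact infDist_le_of_prod_cutoff_ne_zero (fun _ _ h => Finset.coe_subset.2 (hE h)) hρ hp hne
  · exact exists_mem_norm_prod_mul_le (b := b) (fun n => add_le_add (hSnorm n) le_rfl) (hKE n hμ)

end Weighting

section Inclusion

variable {X : Type*} [MetricSpace X] {x₀ : X} {B : Set X} {b₀ : B}

/-- The pairing of the elements of the free space with a fixed `f` in `Lip(X)`. -/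
noncomputable def evalCLM (f : LipZero X x₀) : LipschitzFree X x₀ →L[ℝ] ℝ :=
  ContinuousLinearMap.apply ℝ ℝ f ∘L (LipschitzFree X x₀).subtypeL

theorem exists_linearIsometry_apply_dirac (x₀ : X) (b₀ : B) :
    ∃ i : LipschitzFree B b₀ →ₗᵢ[ℝ] LipschitzFree X x₀,
      ∀ b, i (dirac b₀ b) = dirac x₀ b - dirac x₀ b₀ := by
  have hlip : LipschitzWith 1 fun b : B => dirac x₀ (b : X) - dirac x₀ b₀ :=
    LipschitzWith.of_dist_le_mul fun b c => by
      rw [dist_eq_norm, sub_sub_sub_cancel_right, NNReal.coe_one, one_mul]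
      exact norm_dirac_sub_dirac_le (b : X) c
  let j := lift hlip (sub_self _)
  have hj (f : LipZero X x₀) (g : LipZero B b₀) (hfg : ∀ b : B, f b - f b₀ = g b)
      (μ : LipschitzFree B b₀) : (j μ).1 f = μ.1 g := by
    have heval : evalCLM f ∘L j = evalCLM g := hom_ext fun b => by
      rw [ContinuousLinearMap.comp_apply, lift_dirac]
      exact hfg b
    exact DFunLike.congr_fun heval μ
  refine ⟨⟨j.toLinearMap, fun μ => le_antisymm ?_ ?_⟩, lift_dirac hlip (sub_self _)⟩
  · simpa using j.le_of_opNorm_le (norm_lift_le hlip (sub_self _)) μ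
  · refine ContinuousLinearMap.opNorm_le_bound _ (norm_nonneg _) fun g => ?_
    obtain ⟨f, hf, hfg⟩ := LipZero.exists_extension x₀ g
    calc ‖μ.1 g‖ = ‖(j μ).1 f‖ := by rw [hj f g hfg]
      _ ≤ ‖j μ‖ * ‖g‖ := (j μ).1.le_opNorm_of_le hf

theorem supportedIn_le_range (hx₀ : x₀ ∈ B) {i : LipschitzFree B b₀ →ₗᵢ[ℝ] LipschitzFree X x₀}
    (hi : ∀ b, i (dirac b₀ b) = dirac x₀ b - dirac x₀ b₀) :
    supportedIn x₀ B ≤ LinearMap.range i.toLinearMap := by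
  refine Submodule.topologicalClosure_minimal _ (Submodule.span_le.2 ?_) ?_
  · rintro _ ⟨p, hp, rfl⟩
    refine LinearMap.mem_range.2 ⟨dirac b₀ ⟨p, hp⟩ - dirac b₀ ⟨x₀, hx₀⟩, ?_⟩
    change i _ = _
    simp [hi]
  · rw [LinearMap.coe_range]
    exact i.isometry.isClosedEmbedding.isClosed_range

end Inclusion

end LipschitzFree

theorem HasApproximationProperty.exists_hasFiniteRange_of_subset_supportedIn {X : Type*}
    [MetricSpace X] {x₀ : X} {B : Set X} {b₀ : B}
    (hB : HasApproximationProperty (LipschitzFree B b₀)) (hx₀ : x₀ ∈ B)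
    {K : Set (LipschitzFree X x₀)} (hK : IsCompact K)
    (hKB : K ⊆ LipschitzFree.supportedIn x₀ B) {ε : ℝ} (hε : 0 < ε) :
    ∃ S : LipschitzFree X x₀ →L[ℝ] LipschitzFree X x₀,
      (S : LipschitzFree X x₀ →ₗ[ℝ] LipschitzFree X x₀).HasFiniteRange ∧
        ∀ μ ∈ K, ‖S μ - μ‖ < ε := by
  obtain ⟨i, hi⟩ := LipschitzFree.exists_linearIsometry_apply_dirac x₀ b₀
  refine hB.exists_hasFiniteRange_norm_sub_lt i hK (hKB.trans fun μ hμ => ?_) hε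
  exact LipschitzFree.supportedIn_le_range hx₀ hi hμ

theorem IsClosedIdeal.mem_of_isCompact {X : Type*} [MetricSpace X] {I : Set (Set X)}
    (hI : IsClosedIdeal I) {E M : Set X} (hloc : LocallyModeledOn I E) (hME : M ⊆ E)
    (hM : IsCompact M) : M ∈ I := by
  have hcover : ∃ A ∈ I, M ⊆ A := by
    refine hM.induction_on (p := fun s => ∃ A ∈ I, s ⊆ A) ⟨∅, hI.empty_mem, subset_rfl⟩
      (fun s t hst ⟨A, hA, htA⟩ => ⟨A, hA, hst.trans htA⟩)
      (fun s t ⟨A, hA, hsA⟩ ⟨B, hB, htB⟩ =>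
        ⟨A ∪ B, hI.union_mem A hA B hB, Set.union_subset_union hsA htB⟩) fun x hx => ?_
    obtain ⟨θ, hθ, hball⟩ := hloc x (hME hx)
    exact ⟨E ∩ Metric.closedBall x θ,
      Filter.inter_mem (Filter.mem_of_superset self_mem_nhdsWithin hME)
        (mem_nhdsWithin_of_mem_nhds (Metric.closedBall_mem_nhds x hθ)), _, hball, subset_rfl⟩
  obtain ⟨A, hA, hMA⟩ := hcover
  exact hI.mem_of_subset M A hM.isClosed hMA hA

theorem mainTheorem3_general {X : Type*} [MetricSpace X] [CompleteSpace X] (x₀ : X)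
    (h : ∀ M : Set X, IsCompact M → ∃ B : Set X, M ⊆ B ∧
      ∃ b₀ : B, HasApproximationProperty (LipschitzFree B b₀)) :
    HasApproximationProperty (LipschitzFree X x₀) := by
  refine hasApproximationProperty_of_tendstoUniformlyOn (ι := ℕ) (l := Filter.atTop)
    fun K hK ε hε => ?_
  obtain ⟨M, hM, T, T', hTT', hT', hT'M⟩ :=
    LipschitzFree.exists_tendstoUniformlyOn_mapsTo_supportedIn_isCompact hK hε
  obtain ⟨B, hMB, b₀, hB⟩ := h (insert x₀ M) (hM.insert x₀)
  have hMB' : M ⊆ B := (Set.subset_insert x₀ M).trans hMB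
  have hT'cont : ContinuousOn T' K :=
    hTT'.continuousOn (.of_forall fun n => (T n).continuous.continuousOn)
  have hT'B : T' '' K ⊆ LipschitzFree.supportedIn x₀ B :=
    (hT'M.mono_right (LipschitzFree.supportedIn_mono hMB')).image_subset
  exact ⟨T, T', hTT', hT', hB.exists_hasFiniteRange_of_subset_supportedIn (hMB (Set.mem_insert _ _))
    (hK.image_of_continuousOn hT'cont) hT'B hε⟩

theorem mainTheorem3 {X : Type*} [MetricSpace X] [CompleteSpace X] (x₀ : X)
    (I : Set (Set X)) (hI : IsClosedIdeal I) (hloc : LocallyModeledOn I Set.univ)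
    (hAP : ∀ A ∈ I, ∃ B : Set X, IsClosed B ∧ A ⊆ B ∧
      ∃ b₀ : B, HasApproximationProperty (LipschitzFree B b₀)) :
    HasApproximationProperty (LipschitzFree X x₀) :=
  mainTheorem3_general x₀ fun M hM =>
    let ⟨B, _, hMB, hB⟩ := hAP M (hI.mem_of_isCompact hloc (Set.subset_univ M) hM)
    ⟨B, hMB, hB⟩
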